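/- A linear Fisher market has a finite set of buyers $i$ with budgets $B_i>0$ and a finite set of $m$ goods $j$, one unit of each, and valuations $a_{ij}\ge 0$; every buyer values some good positively and every good is valued positively by some buyer. It is \emph{generic} if $\prod_{(i,j)\in K}a_{ij}\neq\prod_{(i,j)\in K'}a_{ij}$ for all distinct nonempty sets $K,K'$ of buyer-good pairs with non-zero valuations. A pair $(x,p)$ with $x_{ij}\ge 0$, $p_j\ge 0$ is a \emph{market equilibrium} if $\sum_i x_{ij}=1$ for all $j$, $\sum_j x_{ij}p_j\le B_i$ for all $i$, and $\sum_j a_{ij}y_j\le\sum_j a_{ij}x_{ij}$ for every $i$ and every $y\ge 0$ with $\sum_j y_jp_j\le B_i$. Buyer $i$'s strategy set is $S_i=\{b_i\in\mathbb{R}_{\ge 0}^m:\sum_j b_{ij}=B_i\}$, and $S=\prod_i S_i$. A bid profile $b\in S$ induces prices $p_j(b)=\sum_i b_{ij}$ and allocations $x_{ij}(b)=b_{ij}/p_j(b)$ (and $x_{ij}(b)=0$ if $b_{ij}=0$); $b$ is a \emph{market equilibrium bid profile} if $(x(b),p(b))$ is a market equilibrium. The \emph{associated game} has strategy sets $S_i$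 and utilities $$\tilde u_i(b)=\sum_j b_{ij}\ln a_{ij}+\sum_j p_j(b)\bigl(1-\ln p_j(b)\bigr)\in[-\infty,\infty),$$ with $\ln 0=-\infty$, $0\cdot(-\infty)=0$ and $0\ln 0=0$. A Borel probability measure $\mu$ on $S$ is a \emph{correlated equilibrium} of the associated game if $\mathbb{E}_{b\sim\mu}[\tilde u_i(\varphi(b_i),b_{-i})]\le\mathbb{E}_{b\sim\mu}[\tilde u_i(b)]$ for every buyer $i$ and every measurable $\varphi:S_i\to S_i$. A sequence $P^0,P^1,\dots$ of Borel probability measures on $S$ ($P^t$ is the joint law of the bids at time $t$: a point mass for pure bids, a product measure for independent mixed bids) is a \emph{no-swap-regret dynamic} if, for every $i$, every measurable $\varphi:S_i\to S_i$ and every $\varepsilon>0$, for all sufficiently large $T$, $$\sum_{t<T}\mathbb{E}_{P^t}[\tilde u_i(\varphi(b_i),b_{-i})]\le\sum_{t<T}\mathbb{E}_{P^t}[\tilde u_i(b)]+\varepsilon T.$$ \textbf{Corollary.} In every generic linear Fisher market there is exactly one market equilibrium bid profile $b^*$; the point mass $\delta_{b^*}$ is the unique correlated equilibrium of the associated game;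 and for every no-swap-regret dynamic $(P^t)$ in the associated game the empirical distributions of play $\frac1T\sum_{t<T}P^t$ converge weakly to $\delta_{b^*}$ as $T\to\infty$. -/

import Mathlib

open MeasureTheory Filter Topology

/-- A linear Fisher market with buyers `ι` and goods `κ` (one unit of each good): `value i j` is
the value `a_{ij}` of a unit of good `j` for buyer `i`, and `budget i` is the budget `B_i`. -/
structure FisherMarket (ι κ : Type*) where
  value : ι → κ → ℝ
  budget : ι → ℝ
  value_nonneg : ∀ i j, 0 ≤ value i j
  budget_pos : ∀ i, 0 < budget i
  /-- every buyer values some good -/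
  buyer_interested : ∀ i, ∃ j, 0 < value i j
  /-- every good is valued by some buyer -/
  good_valued : ∀ j, ∃ i, 0 < value i j

namespace FisherMarket

variable {ι κ : Type*} [Fintype ι] [Fintype κ]

/-- The market is generic: the non-zero valuations satisfy no multiplicative equality. -/
def IsGeneric (M : FisherMarket ι κ) : Prop :=
  ∀ K K' : Finset (ι × κ), K.Nonempty → K'.Nonempty → K ≠ K' →
    (∀ e ∈ K, M.value e.1 e.2 ≠ 0) → (∀ e ∈ K', M.value e.1 e.2 ≠ 0) →
    ∏ e ∈ K, M.value e.1 e.2 ≠ ∏ e ∈ K', M.value e.1 e.2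

/-- The linear utility `u_i(y) = ∑_j a_{ij} y_j`. -/
def utility (M : FisherMarket ι κ) (i : ι) (y : κ → ℝ) : ℝ := ∑ j, M.value i j * y j

/-- `(x, p)` is a market equilibrium. -/
structure IsEquilibrium (M : FisherMarket ι κ) (x : ι → κ → ℝ) (p : κ → ℝ) : Prop where
  alloc_nonneg : ∀ i j, 0 ≤ x i j
  price_nonneg : ∀ j, 0 ≤ p j
  clearing : ∀ j, ∑ i, x i j = 1
  budget_feasible : ∀ i, ∑ j, x i j * p j ≤ M.budget i
  utility_max : ∀ i, ∀ y : κ → ℝ, (∀ j, 0 ≤ y j) → ∑ j, y j * p j ≤ M.budget i →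
    M.utility i y ≤ M.utility i (x i)

/-- The strategy set `S_i`, a scaled simplex. -/
def bidSet (M : FisherMarket ι κ) (i : ι) : Set (κ → ℝ) :=
  {c | (∀ j, 0 ≤ c j) ∧ ∑ j, c j = M.budget i}

/-- Bid profiles, the elements of `S = ∏_i S_i`, with the product topology and σ-algebra. -/
abbrev BidProfile (M : FisherMarket ι κ) := (i : ι) → M.bidSet i

/-- The price `p_j = ∑_i b_{ij}`. -/
def price (M : FisherMarket ι κ) (b : M.BidProfile) (j : κ) : ℝ := ∑ i, (b i : κ → ℝ) j

/-- The allocation `x_{ij} = b_{ij} / p_j`, which is `0` when `b_{ij} = 0`. -/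
noncomputable def alloc (M : FisherMarket ι κ) (b : M.BidProfile) (i : ι) (j : κ) : ℝ :=
  (b i : κ → ℝ) j / M.price b j

/-- `b` is a market equilibrium bid profile. -/
def IsEquilibriumBid (M : FisherMarket ι κ) (b : M.BidProfile) : Prop :=
  M.IsEquilibrium (M.alloc b) (M.price b)

/-- The associated utility `∑_j b_{ij} ln a_{ij} + ∑_j p_j (1 - ln p_j)`, where `ln 0 = -∞`,
`0 * (-∞) = 0` and `0 * ln 0 = 0`. It is `-∞` if buyer `i` bids on a good of value `0` to `i`,
and finite otherwise. -/
noncomputable def assocUtility (M : FisherMarket ι κ) (i : ι) (b : M.BidProfile) : EReal :=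
  ∑ j, ((b i : κ → ℝ) j : EReal) * ENNReal.log (ENNReal.ofReal (M.value i j))
    + ((∑ j, M.price b j * (1 - Real.log (M.price b j)) : ℝ) : EReal)

/-- The expectation of an extended-real function, `∫ f⁺ - ∫ f⁻`. It is used only for functions
that are bounded above. -/
noncomputable def expectation {Ω : Type*} [MeasurableSpace Ω] (μ : ProbabilityMeasure Ω)
    (f : Ω → EReal) : EReal :=
  ((∫⁻ ω, (f ω).toENNReal ∂(μ : Measure Ω) : ENNReal) : EReal)
    - ((∫⁻ ω, (-f ω).toENNReal ∂(μ : Measure Ω) : ENNReal) : EReal)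

/-- The profile in which `i` plays `φ (b i)` instead of `b i`. -/
def swap [DecidableEq ι] (M : FisherMarket ι κ) (i : ι) (φ : M.bidSet i → M.bidSet i)
    (b : M.BidProfile) : M.BidProfile :=
  Function.update b i (φ (b i))

/-- `μ` is a correlated equilibrium of the associated game. -/
def IsCorrelatedEquilibrium [DecidableEq ι] (M : FisherMarket ι κ)
    (μ : ProbabilityMeasure M.BidProfile) : Prop :=
  ∀ (i : ι) (φ : M.bidSet i → M.bidSet i), Measurable φ →
    expectation μ (fun b => M.assocUtility i (M.swap i φ b)) ≤ expectation μ (M.assocUtility i)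

/-- The sequence of (possibly randomized) plays `P 0, P 1, …` has no swap regret in the associated
game: for every player and every swap function `φ`, the regret over the first `T` rounds for not
having played `φ (b_i)` whenever `b_i` was played is at most `o(T)`. The joint law of the bids at
time `t` is `P t`: a point mass for pure bids, a product measure for independent mixed bids. -/
def NoSwapRegret [DecidableEq ι] (M : FisherMarket ι κ)
    (P : ℕ → ProbabilityMeasure M.BidProfile) : Prop :=
  ∀ (i : ι) (φ : M.bidSet i → M.bidSet i), Measurable φ → ∀ ε : ℝ, 0 < ε →
    ∀ᶠ T : ℕ in atTop,
      ∑ t ∈ Finset.range T, expectation (P t) (fun b => M.assocUtility i (M.swap i φ b))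
        ≤ ∑ t ∈ Finset.range T, expectation (P t) (M.assocUtility i) + ((ε * T : ℝ) : EReal)

/-- The empirical distribution of play over the first `T + 1` rounds,
`(1 / (T + 1)) ∑_{t ≤ T} P t`. -/
noncomputable def empirical {Ω : Type*} [MeasurableSpace Ω] (P : ℕ → ProbabilityMeasure Ω)
    (T : ℕ) : ProbabilityMeasure Ω :=
  ⟨((T + 1 : ℕ) : ENNReal)⁻¹ • ∑ t ∈ Finset.range (T + 1), (P t : Measure Ω), ⟨by
    simp only [Measure.smul_apply, Measure.coe_finsetSum, Finset.sum_apply, measure_univ,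
      Finset.sum_const, Finset.card_range, nsmul_eq_mul, mul_one, smul_eq_mul]
    exact ENNReal.inv_mul_cancel (by simp) (ENNReal.natCast_ne_top _)⟩⟩

end FisherMarket

/-!
The associated game has an exact potential: up to terms that do not depend on `i`'s own bid, the
utility of every buyer `i` is the concave function
`potential b = ∑ b_{ij} log a_{ij} + ∑ p_j (1 - log p_j)` (`potential_update_sub`).

A profile is an equilibrium bid profile exactly when it is balanced: all prices are positive and
every buyer bids only on goods with the best ratio of value to price (`isEquilibriumBid_iff`). By
first-order conditions the balanced profiles are the maximizers of the potential among admissible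
profiles, those without bids on worthless goods (`isBalanced_of_isMax`, `IsBalanced.potential_le`),
so one exists by compactness. Strict concavity makes the prices unique, and two balanced profiles
with equal prices differ by a circulation on the pairs of best ratio; a cycle in it would give two
sets of pairs with the same product of valuations, against genericity
(`IsBalanced.eq_of_price_eq`).

For the dynamics, let every buyer consider replacing each bid by a point slightly closer to the
equilibrium bid. By concavity the sum of the gains is, to first order, at least the gap between the
maximal and the current potential. The potential is not differentiable where a price vanishes, but
the estimate holds uniformly on the whole strategy space (`exists_le_sum_payoff_blend_sub`).
Vanishing swap regret therefore forces the average potential gap to `0`, and as the maximizer is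
unique the empirical distributions concentrate there (`NoSwapRegret.tendsto_empirical`). The
value `-∞` of the utility only matters in that it makes inadmissible bids null sets
(`NoSwapRegret.ae_admissibleBid`), after which all expectations are ordinary integrals.

A correlated equilibrium is a constant dynamic without swap regret, hence equal to its own limit.
-/

/-! ### The function `x (1 - log x)` -/

/-- The function `x (1 - log x)`, concave on `[0, ∞)` with derivative `-log x`. -/
noncomputable def mulOneSubLog (x : ℝ) : ℝ := x * (1 - Real.log x)

theorem continuous_mulOneSubLog : Continuous mulOneSubLog := by
  have h : mulOneSubLog = fun x => x + Real.negMulLog x := by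
    funext x
    simp only [mulOneSubLog, Real.negMulLog]
    ring
  rw [h]
  fun_prop

theorem mulOneSubLog_sub_lt {p q : ℝ} (hp : 0 < p) (hq : 0 ≤ q) (hpq : q ≠ p) :
    mulOneSubLog q - mulOneSubLog p < -Real.log p * (q - p) := by
  unfold mulOneSubLog
  rcases hq.eq_or_lt with rfl | hq
  · simp only [zero_mul]
    nlinarith
  · have h1 : Real.log (p / q) < p / q - 1 := by
      refine Real.log_lt_sub_one_of_pos (by positivity) ?_
      rw [Ne, div_eq_one_iff_eq hq.ne']
      exact hpq.symm
    rw [Real.log_div hp.ne' hq.ne'] at h1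
    have h2 := mul_lt_mul_of_pos_left h1 hq
    have h3 : q * (p / q - 1) = p - q := by field_simp
    rw [h3] at h2
    linarith

/-- The gradient inequality for `x (1 - log x)` at `p`. -/
theorem mulOneSubLog_sub_le {p q : ℝ} (hp : 0 < p) (hq : 0 ≤ q) :
    mulOneSubLog q - mulOneSubLog p ≤ -Real.log p * (q - p) := by
  by_cases h : q = p
  · simp [h]
  · exact (mulOneSubLog_sub_lt hp hq h).le

/-- A uniform version of the gradient inequality at the endpoint `p + θ * (c - b)`, in which the
slope `log (p + θ * B)` depends neither on `b` nor on `c`. -/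
theorem mul_log_add_le {p b c B θ : ℝ} (hb : 0 ≤ b) (hbp : b ≤ p) (hpB : p ≤ B) (hc : 0 ≤ c)
    (hcB : c ≤ B) (hθ : 0 < θ) (hθ' : θ ≤ 1 / 2) :
    (c - b) * Real.log (p + θ * (c - b)) ≤ (c - b) * Real.log (p + θ * B) + 4 * θ * B := by
  have hB : 0 ≤ B := hc.trans hcB
  rcases lt_trichotomy (c - b) 0 with h | h | h
  · have hp : 0 < p := by linarith
    -- here `p + θ * (c - b) ≥ (1 - θ) * p`, and `log (r / q) ≤ r / q - 1` bounds the difference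
    have hq : p / 2 ≤ p + θ * (c - b) := by nlinarith
    have hq0 : 0 < p + θ * (c - b) := by linarith
    have hr0 : 0 < p + θ * B := by positivity
    have h1 : Real.log ((p + θ * B) / (p + θ * (c - b)))
        ≤ (p + θ * B) / (p + θ * (c - b)) - 1 := Real.log_le_sub_one_of_pos (by positivity)
    rw [Real.log_div hr0.ne' hq0.ne'] at h1
    have h2 : (p + θ * B) / (p + θ * (c - b)) - 1 ≤ 4 * θ * B / p := by
      rw [div_sub_one hq0.ne', div_le_div_iff₀ hq0 hp]
      have h3 : 4 * θ * B * (p / 2) ≤ 4 * θ * B * (p + θ * (c - b)) :=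
        mul_le_mul_of_nonneg_left hq (by positivity)
      have h4 : θ * (B - (c - b)) * p ≤ θ * (2 * B) * p := by
        refine mul_le_mul_of_nonneg_right (mul_le_mul_of_nonneg_left ?_ hθ.le) hp.le
        linarith
      nlinarith
    have h5 : (b - c) * (4 * θ * B / p) ≤ 4 * θ * B := by
      rw [mul_div_assoc', div_le_iff₀ hp, mul_comm]
      exact mul_le_mul_of_nonneg_left (by linarith) (by positivity)
    have h6 := mul_le_mul_of_nonneg_left (h1.trans h2) (show 0 ≤ b - c by linarith)
    linarith
  · rw [h]
    simp only [zero_mul, zero_add]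
    positivity
  · have h1 : Real.log (p + θ * (c - b)) ≤ Real.log (p + θ * B) := by
      refine Real.log_le_log (by nlinarith) ?_
      have : θ * (c - b) ≤ θ * B := mul_le_mul_of_nonneg_left (by linarith) hθ.le
      linarith
    have h2 := mul_le_mul_of_nonneg_left h1 h.le
    have : 0 ≤ 4 * θ * B := by positivity
    linarith

/-- Weights attaining at least the maximum of `w` on average are supported on maximizers of `w`. -/
theorem le_of_mul_le_sum_mul {κ : Type*} [Fintype κ] {w b : κ → ℝ} {S : Set κ} {B : ℝ}
    (hb : ∀ j, 0 ≤ b j) (hS : ∀ j, 0 < b j → j ∈ S) (hB : ∑ j, b j = B)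
    (h : ∀ k ∈ S, B * w k ≤ ∑ j, b j * w j) {j k : κ} (hj : 0 < b j) (hk : k ∈ S) :
    w k ≤ w j := by
  obtain ⟨m, hm, hmax⟩ := S.toFinite.exists_maximalFor w S ⟨k, hk⟩
  have hmax' : ∀ l ∈ S, w l ≤ w m := fun l hl => by
    rcases le_total (w m) (w l) with h' | h'
    · exact hmax hl h'
    · exact h'
  have h0 : ∀ l ∈ Finset.univ, 0 ≤ b l * (w m - w l) := fun l _ => by
    rcases (hb l).eq_or_lt with h' | h'
    · simp [← h']
    · exact mul_nonneg (hb l) (sub_nonneg.2 (hmax' l (hS l h')))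
  have h1 : ∑ l, b l * (w m - w l) = 0 := by
    refine le_antisymm ?_ (Finset.sum_nonneg h0)
    simp only [mul_sub, Finset.sum_sub_distrib, ← Finset.sum_mul, hB]
    linarith [h m hm]
  have h2 := (Finset.sum_eq_zero_iff_of_nonneg h0).1 h1 j (Finset.mem_univ j)
  have h3 : w m = w j := by
    rcases mul_eq_zero.1 h2 with h' | h'
    · exact absurd h' hj.ne'
    · linarith
  exact h3 ▸ hmax' k hk

/-! ### Unique maximizers and extended-real sums -/

/-- If `x₀` is the unique maximizer of `F` on a compact set, the oscillation of `f` at `x₀` is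
controlled by the gap to the maximum. -/
theorem exists_abs_sub_le_of_unique_max {X : Type*} [TopologicalSpace X] {K : Set X}
    (hK : IsCompact K) {F f : X → ℝ} (hF : Continuous F) (hf : Continuous f) {x₀ : X}
    (hmax : ∀ x ∈ K, x ≠ x₀ → F x < F x₀) {δ : ℝ} (hδ : 0 < δ) :
    ∃ C : ℝ, 0 ≤ C ∧ ∀ x ∈ K, |f x - f x₀| ≤ δ + C * (F x₀ - F x) := by
  have hg : Continuous fun x => |f x - f x₀| := (hf.sub continuous_const).abs
  have hle : ∀ x ∈ K, 0 ≤ F x₀ - F x := fun x hx => by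
    by_cases h : x = x₀
    · simp [h]
    · exact sub_nonneg.2 (hmax x hx h).le
  have hK' : IsCompact (K ∩ {x | δ ≤ |f x - f x₀|}) :=
    hK.inter_right (isClosed_le continuous_const hg)
  rcases (K ∩ {x | δ ≤ |f x - f x₀|}).eq_empty_or_nonempty with he | hne
  · refine ⟨0, le_rfl, fun x hx => ?_⟩
    by_contra! h
    have : x ∈ K ∩ {x | δ ≤ |f x - f x₀|} := ⟨hx, by
      change δ ≤ _
      linarith⟩
    simp [he] at this
  · obtain ⟨y, hy, hymax⟩ := hK'.exists_isMaxOn hne hF.continuousOn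
    obtain ⟨z, hz, hzmax⟩ := hK'.exists_isMaxOn hne hg.continuousOn
    have hy0 : 0 < F x₀ - F y := sub_pos.2 (hmax y hy.1 fun h => by
      have := hy.2
      simp only [h, Set.mem_ofPred_eq, sub_self, abs_zero] at this
      linarith)
    refine ⟨|f z - f x₀| / (F x₀ - F y), by positivity, fun x hx => ?_⟩
    rcases lt_or_ge |f x - f x₀| δ with h | h
    · have := mul_nonneg (div_nonneg (abs_nonneg (f z - f x₀)) hy0.le) (hle x hx)
      linarith
    · have h1 : |f x - f x₀| ≤ |f z - f x₀| := hzmax ⟨hx, h⟩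
      have h2 : F x ≤ F y := hymax ⟨hx, h⟩
      have h3 : |f z - f x₀| ≤ |f z - f x₀| / (F x₀ - F y) * (F x₀ - F x) := by
        rw [div_mul_eq_mul_div, le_div_iff₀ hy0]
        exact mul_le_mul_of_nonneg_left (by linarith) (abs_nonneg _)
      linarith

theorem EReal.coe_finset_sum {α : Type*} (s : Finset α) (f : α → ℝ) :
    ((∑ a ∈ s, f a : ℝ) : EReal) = ∑ a ∈ s, (f a : EReal) := by
  classical
  induction s using Finset.induction_on with
  | empty => simp
  | insert a s ha ih => rw [Finset.sum_insert ha, Finset.sum_insert ha, EReal.coe_add, ih]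

theorem EReal.finset_sum_eq_bot {α : Type*} {s : Finset α} {f : α → EReal} {a : α}
    (ha : a ∈ s) (h : f a = ⊥) : ∑ a ∈ s, f a = ⊥ := by
  classical
  rw [← Finset.add_sum_erase s f ha, h, EReal.bot_add]

namespace FisherMarket

variable {ι κ : Type*} [Fintype κ]

/-! ### Bids -/

theorem bid_nonneg {M : FisherMarket ι κ} {i : ι} (c : M.bidSet i) (j : κ) : 0 ≤ c.1 j := c.2.1 j

theorem sum_bid {M : FisherMarket ι κ} {i : ι} (c : M.bidSet i) : ∑ j, c.1 j = M.budget i := c.2.2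

theorem bid_le_budget {M : FisherMarket ι κ} {i : ι} (c : M.bidSet i) (j : κ) :
    c.1 j ≤ M.budget i := by
  rw [← sum_bid c]
  exact Finset.single_le_sum (fun k _ => bid_nonneg c k) (Finset.mem_univ j)

theorem exists_bid_pos {M : FisherMarket ι κ} {i : ι} (c : M.bidSet i) : ∃ j, 0 < c.1 j := by
  by_contra! h
  have h1 : ∑ j, c.1 j ≤ 0 := Finset.sum_nonpos fun j _ => h j
  rw [sum_bid c] at h1
  exact absurd (M.budget_pos i) (not_lt.2 h1)

theorem continuous_bid {M : FisherMarket ι κ} (i : ι) (j : κ) :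
    Continuous fun b : M.BidProfile => (b i).1 j :=
  (continuous_apply j).comp (continuous_subtype_val.comp (continuous_apply i))

/-- A bid of buyer `i` is admissible if nothing is bid on goods worthless to `i`. -/
def AdmissibleBid (M : FisherMarket ι κ) (i : ι) (c : M.bidSet i) : Prop :=
  ∀ j, M.value i j = 0 → c.1 j = 0

theorem continuous_swap [DecidableEq ι] {M : FisherMarket ι κ} (i : ι) {φ : M.bidSet i → M.bidSet i} (hφ : Continuous φ) :
    Continuous (M.swap i φ) :=
  continuous_id.update i (hφ.comp (continuous_apply i))

/-- The point `(1 - θ) x + θ y` of the segment from `x` to `y` in the strategy set. -/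
def blend {M : FisherMarket ι κ} {i : ι} (θ : unitInterval) (y x : M.bidSet i) : M.bidSet i :=
  ⟨fun j => x.1 j + θ * (y.1 j - x.1 j), fun j => by
    nlinarith [bid_nonneg x j, bid_nonneg y j, θ.2.1, θ.2.2,
      mul_nonneg θ.2.1 (bid_nonneg y j), mul_nonneg (sub_nonneg.2 θ.2.2) (bid_nonneg x j)], by
    rw [Finset.sum_add_distrib, ← Finset.mul_sum, Finset.sum_sub_distrib, sum_bid, sum_bid,
      sub_self, mul_zero, add_zero]⟩

theorem continuous_blend {M : FisherMarket ι κ} {i : ι} (θ : unitInterval) (y : M.bidSet i) :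
    Continuous (blend θ y) := by
  have h : ∀ j, Continuous fun x : M.bidSet i => x.1 j := fun j =>
    (continuous_apply j).comp continuous_subtype_val
  exact Continuous.subtype_mk (continuous_pi fun j =>
    (h j).add (continuous_const.mul (continuous_const.sub (h j)))) _

theorem AdmissibleBid.blend {M : FisherMarket ι κ} {i : ι} (θ : unitInterval) {x y : M.bidSet i}
    (hy : M.AdmissibleBid i y) (hx : M.AdmissibleBid i x) : M.AdmissibleBid i (blend θ y x) :=
  fun j hj => by simp [FisherMarket.blend, hx j hj, hy j hj]

open Classical in
/-- The bid spending the whole budget on the good `k`. -/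
noncomputable def singleBid (M : FisherMarket ι κ) (i : ι) (k : κ) : M.bidSet i :=
  ⟨fun j => if j = k then M.budget i else 0, fun j => by
    have := (M.budget_pos i).le
    dsimp only
    split_ifs <;> simp [this], by simp⟩

theorem admissibleBid_singleBid {M : FisherMarket ι κ} {i : ι} {k : κ} (hk : M.value i k ≠ 0) :
    M.AdmissibleBid i (M.singleBid i k) := fun j hj => by
  have : j ≠ k := fun h => hk (h ▸ hj)
  simp [singleBid, this]

instance (M : FisherMarket ι κ) (i : ι) : CompactSpace (M.bidSet i) := by
  refine isCompact_iff_compactSpace.1 ((isCompact_Icc (a := (0 : κ → ℝ))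
    (b := fun _ => M.budget i)).of_isClosed_subset ?_ ?_)
  · have h : M.bidSet i = (⋂ j, {c : κ → ℝ | 0 ≤ c j}) ∩ {c | ∑ j, c j = M.budget i} := by
      ext c
      simp [bidSet]
    rw [h]
    exact (isClosed_iInter fun j => isClosed_le continuous_const (continuous_apply j)).inter
      (isClosed_eq (continuous_finsetSum _ fun j _ => continuous_apply j) continuous_const)
  · intro c hc
    exact ⟨fun j => bid_nonneg ⟨c, hc⟩ j, fun j => bid_le_budget ⟨c, hc⟩ j⟩

theorem isClosed_admissible (M : FisherMarket ι κ) :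
    IsClosed {b : M.BidProfile | ∀ i, M.AdmissibleBid i (b i)} := by
  simp only [AdmissibleBid, Set.ofPred_forall]
  exact isClosed_iInter fun i => isClosed_iInter fun j => isClosed_iInter fun _ =>
    isClosed_eq (continuous_bid i j) continuous_const

variable [Fintype ι]

theorem bid_le_price {M : FisherMarket ι κ} (b : M.BidProfile) (i : ι) (j : κ) :
    (b i).1 j ≤ M.price b j :=
  Finset.single_le_sum (f := fun i => (b i).1 j) (fun i _ => bid_nonneg (b i) j)
    (Finset.mem_univ i)

theorem price_nonneg {M : FisherMarket ι κ} (b : M.BidProfile) (j : κ) : 0 ≤ M.price b j :=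
  Finset.sum_nonneg fun i _ => bid_nonneg (b i) j

theorem price_le_sum_budget {M : FisherMarket ι κ} (b : M.BidProfile) (j : κ) :
    M.price b j ≤ ∑ i, M.budget i :=
  Finset.sum_le_sum fun i _ => bid_le_budget (b i) j

/-! ### Balanced bid profiles -/

/-- All prices are positive and every buyer bids only on goods of maximal value per unit of
price. -/
structure IsBalanced (M : FisherMarket ι κ) (b : M.BidProfile) : Prop where
  price_pos : ∀ j, 0 < M.price b j
  ratio_le : ∀ i j k, 0 < (b i).1 j →
    M.value i k / M.price b k ≤ M.value i j / M.price b j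

theorem IsBalanced.value_pos {M : FisherMarket ι κ} {b : M.BidProfile} (hb : M.IsBalanced b)
    {i : ι} {j : κ} (hj : 0 < (b i).1 j) : 0 < M.value i j := by
  obtain ⟨k, hk⟩ := M.buyer_interested i
  have h := (div_pos hk (hb.price_pos k)).trans_le (hb.ratio_le i j k hj)
  by_contra! h'
  exact absurd h (not_lt.2 (div_nonpos_of_nonpos_of_nonneg h' (hb.price_pos j).le))

theorem IsBalanced.admissibleBid {M : FisherMarket ι κ} {b : M.BidProfile} (hb : M.IsBalanced b)
    (i : ι) : M.AdmissibleBid i (b i) := fun j hj => by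
  by_contra h
  exact (hb.value_pos ((bid_nonneg (b i) j).lt_of_ne' h)).ne' hj

theorem IsBalanced.log_ratio_le {M : FisherMarket ι κ} {b : M.BidProfile} (hb : M.IsBalanced b)
    {i : ι} {j k : κ} (hj : 0 < (b i).1 j) (hk : 0 < M.value i k) :
    Real.log (M.value i k) - Real.log (M.price b k)
      ≤ Real.log (M.value i j) - Real.log (M.price b j) := by
  rw [← Real.log_div hk.ne' (hb.price_pos k).ne',
    ← Real.log_div (hb.value_pos hj).ne' (hb.price_pos j).ne']
  exact Real.log_le_log (div_pos hk (hb.price_pos k)) (hb.ratio_le i j k hj)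

theorem isBalanced_of_isEquilibriumBid {M : FisherMarket ι κ} {b : M.BidProfile}
    (hb : M.IsEquilibriumBid b) : M.IsBalanced b := by
  classical
  have hp : ∀ j, 0 < M.price b j := fun j => by
    refine (price_nonneg b j).lt_of_ne' fun h => ?_
    -- a good of price `0` would not be allocated, since division by `0` gives `0`
    have h1 := hb.clearing j
    simp [alloc, h] at h1
  refine ⟨hp, fun i j k hj => ?_⟩
  refine le_of_mul_le_sum_mul (w := fun j => M.value i j / M.price b j) (b := (b i).1)
    (S := Set.univ) (bid_nonneg (b i)) (fun _ _ => Set.mem_univ _) (sum_bid (b i)) ?_ hj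
    (Set.mem_univ k)
  intro l _
  have h1 := hb.utility_max i (Pi.single l (M.budget i / M.price b l)) (fun j => by
      by_cases h : j = l
      · subst h
        simpa using (div_pos (M.budget_pos i) (hp j)).le
      · simp [h])
    (by simp [Pi.single_apply, (hp l).ne'])
  simp only [utility, alloc, Pi.single_apply, mul_ite, mul_zero, Finset.sum_ite_eq',
    Finset.mem_univ, if_true] at h1
  calc M.budget i * (M.value i l / M.price b l) = M.value i l * (M.budget i / M.price b l) := by
        ring
    _ ≤ _ := h1
    _ = _ := Finset.sum_congr rfl fun j _ => by
        ring

theorem IsBalanced.isEquilibriumBid {M : FisherMarket ι κ} {b : M.BidProfile}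
    (hb : M.IsBalanced b) : M.IsEquilibriumBid b := by
  have hp := hb.price_pos
  have hx : ∀ i j, M.alloc b i j * M.price b j = (b i).1 j := fun i j =>
    div_mul_cancel₀ _ (hp j).ne'
  refine ⟨fun i j => div_nonneg (bid_nonneg (b i) j) (hp j).le, fun j => (hp j).le, fun j => ?_,
    fun i => ?_, fun i y hy hyB => ?_⟩
  · simp only [alloc, ← Finset.sum_div]
    exact div_self (hp j).ne'
  · simp only [hx]
    exact (sum_bid (b i)).le
  · obtain ⟨l, hl⟩ := exists_bid_pos (b i)
    set m := M.value i l / M.price b l with hm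
    have hm0 : 0 ≤ m := div_nonneg (M.value_nonneg i l) (hp l).le
    calc M.utility i y ≤ ∑ j, m * (y j * M.price b j) := by
          refine Finset.sum_le_sum fun j _ => ?_
          have h1 := (div_le_iff₀ (hp j)).1 (hb.ratio_le i l j hl)
          nlinarith [mul_le_mul_of_nonneg_right h1 (hy j)]
      _ ≤ m * M.budget i := by
          rw [← Finset.mul_sum]
          exact mul_le_mul_of_nonneg_left hyB hm0
      _ = ∑ j, m * (b i).1 j := by rw [← Finset.mul_sum, sum_bid]
      _ = M.utility i (M.alloc b i) := by
          refine Finset.sum_congr rfl fun j _ => ?_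
          rcases (bid_nonneg (b i) j).eq_or_lt with h | h
          · change _ = M.value i j * ((b i).1 j / M.price b j)
            rw [← h]
            simp
          · rw [hm, le_antisymm (hb.ratio_le i j l h) (hb.ratio_le i l j hl)]
            change _ = M.value i j * ((b i).1 j / M.price b j)
            ring

theorem isEquilibriumBid_iff {M : FisherMarket ι κ} {b : M.BidProfile} :
    M.IsEquilibriumBid b ↔ M.IsBalanced b :=
  ⟨isBalanced_of_isEquilibriumBid, IsBalanced.isEquilibriumBid⟩

/-! ### The potential -/

/-- The real-valued expression of the associated utility, with `log 0` read as `0`. It agrees with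
`assocUtility` when the bid of `i` is admissible. -/
noncomputable def payoff (M : FisherMarket ι κ) (i : ι) (b : M.BidProfile) : ℝ :=
  ∑ j, (b i).1 j * Real.log (M.value i j) + ∑ j, mulOneSubLog (M.price b j)

/-- The exact potential of the associated game, the objective of Shmyrev's convex program, with
`log 0` read as `0`. -/
noncomputable def potential (M : FisherMarket ι κ) (b : M.BidProfile) : ℝ :=
  ∑ i, ∑ j, (b i).1 j * Real.log (M.value i j) + ∑ j, mulOneSubLog (M.price b j)

theorem continuous_price {M : FisherMarket ι κ} (j : κ) :
    Continuous fun b : M.BidProfile => M.price b j :=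
  continuous_finsetSum _ fun i _ => continuous_bid i j

theorem continuous_payoff (M : FisherMarket ι κ) (i : ι) : Continuous (M.payoff i) :=
  (continuous_finsetSum _ fun j _ => (continuous_bid i j).mul continuous_const).add
    (continuous_finsetSum _ fun j _ => continuous_mulOneSubLog.comp (continuous_price j))

theorem continuous_potential (M : FisherMarket ι κ) : Continuous M.potential :=
  (continuous_finsetSum _ fun i _ =>
      continuous_finsetSum _ fun j _ => (continuous_bid i j).mul continuous_const).add
    (continuous_finsetSum _ fun j _ => continuous_mulOneSubLog.comp (continuous_price j))

theorem sum_update_sub_sum [DecidableEq ι] {M : FisherMarket ι κ} (b : M.BidProfile) (i : ι)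
    (c : M.bidSet i) (f : (i : ι) → M.bidSet i → ℝ) :
    ∑ l, f l (Function.update b i c l) - ∑ l, f l (b l) = f i c - f i (b i) := by
  rw [← Finset.sum_sub_distrib, Finset.sum_eq_single i]
  · simp
  · intro l _ hl
    simp [hl]
  · simp

theorem price_update [DecidableEq ι] {M : FisherMarket ι κ} (b : M.BidProfile) (i : ι)
    (c : M.bidSet i) (j : κ) :
    M.price (Function.update b i c) j = M.price b j + (c.1 j - (b i).1 j) := by
  have := sum_update_sub_sum b i c fun _ x => x.1 j
  unfold price
  linarith

/-- The game with utilities `payoff` is an exact potential game. -/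
theorem potential_update_sub [DecidableEq ι] {M : FisherMarket ι κ} (b : M.BidProfile) (i : ι)
    (c : M.bidSet i) :
    M.potential (Function.update b i c) - M.potential b
      = M.payoff i (Function.update b i c) - M.payoff i b := by
  have := sum_update_sub_sum b i c fun i x => ∑ j, x.1 j * Real.log (M.value i j)
  simp only [potential, payoff, Function.update_self]
  linarith

theorem potential_sub {M : FisherMarket ι κ} (b c : M.BidProfile) :
    M.potential c - M.potential b = ∑ i, ∑ j, ((c i).1 j - (b i).1 j) * Real.log (M.value i j)
      + ∑ j, (mulOneSubLog (M.price c j) - mulOneSubLog (M.price b j)) := by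
  simp only [potential, sub_mul, Finset.sum_sub_distrib]
  ring

theorem IsBalanced.sum_mul_log_ratio_nonpos {M : FisherMarket ι κ} {b : M.BidProfile}
    (hb : M.IsBalanced b) (i : ι) {c : M.bidSet i} (hc : M.AdmissibleBid i c) :
    ∑ j, (c.1 j - (b i).1 j) * (Real.log (M.value i j) - Real.log (M.price b j)) ≤ 0 := by
  obtain ⟨l, hl⟩ := exists_bid_pos (b i)
  set m := Real.log (M.value i l) - Real.log (M.price b l)
  calc _ ≤ ∑ j, (c.1 j - (b i).1 j) * m := by
        refine Finset.sum_le_sum fun j _ => ?_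
        have h1 : c.1 j * (Real.log (M.value i j) - Real.log (M.price b j)) ≤ c.1 j * m := by
          by_cases hv : M.value i j = 0
          · simp [hc j hv]
          · exact mul_le_mul_of_nonneg_left
              (hb.log_ratio_le hl ((M.value_nonneg i j).lt_of_ne' hv)) (bid_nonneg c j)
        have h2 : (b i).1 j * m
            ≤ (b i).1 j * (Real.log (M.value i j) - Real.log (M.price b j)) := by
          rcases (bid_nonneg (b i) j).eq_or_lt with h | h
          · simp [← h]
          · exact mul_le_mul_of_nonneg_left (hb.log_ratio_le h (hb.value_pos hl)) h.le
        linarith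
    _ = 0 := by
        rw [← Finset.sum_mul, Finset.sum_sub_distrib, sum_bid, sum_bid, sub_self, zero_mul]

theorem sum_price_sub_mul {M : FisherMarket ι κ} (b c : M.BidProfile) (w : κ → ℝ) :
    ∑ j, (M.price c j - M.price b j) * w j = ∑ i, ∑ j, ((c i).1 j - (b i).1 j) * w j := by
  rw [Finset.sum_comm]
  refine Finset.sum_congr rfl fun j _ => ?_
  rw [← Finset.sum_mul, Finset.sum_sub_distrib]
  rfl

theorem IsBalanced.sum_linear_le {M : FisherMarket ι κ} {b : M.BidProfile} (hb : M.IsBalanced b)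
    {c : M.BidProfile} (hc : ∀ i, M.AdmissibleBid i (c i)) :
    ∑ i, ∑ j, ((c i).1 j - (b i).1 j) * Real.log (M.value i j)
      + ∑ j, -Real.log (M.price b j) * (M.price c j - M.price b j) ≤ 0 := by
  have h1 := Finset.sum_nonpos fun i (_ : i ∈ Finset.univ) =>
    hb.sum_mul_log_ratio_nonpos i (hc i)
  have h2 := sum_price_sub_mul b c fun j => Real.log (M.price b j)
  simp only [mul_sub, Finset.sum_sub_distrib] at h1
  simp only [neg_mul, Finset.sum_neg_distrib, mul_comm (Real.log _) (M.price c _ - _), h2]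
  linarith

/-- A balanced profile maximizes the potential among admissible profiles. -/
theorem IsBalanced.potential_le {M : FisherMarket ι κ} {b : M.BidProfile} (hb : M.IsBalanced b)
    {c : M.BidProfile} (hc : ∀ i, M.AdmissibleBid i (c i)) : M.potential c ≤ M.potential b := by
  have h1 := hb.sum_linear_le hc
  have h2 := potential_sub b c
  have h3 := Finset.sum_le_sum fun j (_ : j ∈ Finset.univ) =>
    mulOneSubLog_sub_le (hb.price_pos j) (price_nonneg c j)
  linarith

/-- By strict concavity in the prices, maximizers of the potential have the prices of a balanced
profile. -/
theorem IsBalanced.price_eq {M : FisherMarket ι κ} {b : M.BidProfile} (hb : M.IsBalanced b)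
    {c : M.BidProfile} (hc : ∀ i, M.AdmissibleBid i (c i))
    (h : M.potential b ≤ M.potential c) : M.price c = M.price b := by
  by_contra hne
  obtain ⟨k, hk⟩ := Function.ne_iff.1 hne
  have h1 := hb.sum_linear_le hc
  have h2 := potential_sub b c
  have h3 := Finset.sum_lt_sum (fun j (_ : j ∈ Finset.univ) =>
    mulOneSubLog_sub_le (hb.price_pos j) (price_nonneg c j))
    ⟨k, Finset.mem_univ k, mulOneSubLog_sub_lt (hb.price_pos k) (price_nonneg c k) hk⟩
  linarith

/-! ### Uniqueness of the balanced profile -/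

/-- If two balanced profiles with equal prices differ, their difference is a circulation on the
bipartite graph of optimal buyer-good pairs. An alternating cycle in it yields two disjoint sets
of pairs with equal products of valuations. The cycle is found as a set of periodic points: from a
good one passes to a buyer whose bid decreases, and from the buyer to a good on which the bid
increases. -/
theorem IsBalanced.eq_of_price_eq {M : FisherMarket ι κ} (hM : M.IsGeneric) {b c : M.BidProfile}
    (hb : M.IsBalanced b) (hc : M.IsBalanced c) (hp : M.price c = M.price b) : c = b := by
  classical
  by_contra hne
  have hrow : ∀ i, ∑ j, ((c i).1 j - (b i).1 j) = 0 := fun i => by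
    rw [Finset.sum_sub_distrib, sum_bid, sum_bid, sub_self]
  have hcol : ∀ j, ∑ i, ((c i).1 j - (b i).1 j) = 0 := fun j => by
    rw [Finset.sum_sub_distrib, sub_eq_zero]
    exact congrFun hp j
  have hrow_pos : ∀ i j, (c i).1 j < (b i).1 j → ∃ k, (b i).1 k < (c i).1 k := by
    intro i j h
    by_contra! h'
    exact (Finset.sum_neg' (fun k _ => sub_nonpos.2 (h' k))
      ⟨j, Finset.mem_univ j, sub_neg.2 h⟩).ne (hrow i)
  have hcol_neg : ∀ i j, (b i).1 j < (c i).1 j → ∃ l, (c l).1 j < (b l).1 j := by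
    intro i j h
    by_contra! h'
    exact (Finset.sum_pos' (fun l _ => sub_nonneg.2 (h' l))
      ⟨i, Finset.mem_univ i, sub_pos.2 h⟩).ne' (hcol j)
  let J := {j : κ // ∃ i, (c i).1 j < (b i).1 j}
  have hJ : Nonempty J := by
    obtain ⟨i, hi⟩ := Function.ne_iff.1 hne
    obtain ⟨j, hj⟩ := Function.ne_iff.1 (fun h => hi (Subtype.ext h))
    rcases lt_or_gt_of_ne hj with h | h
    · exact ⟨j, i, h⟩
    · obtain ⟨l, hl⟩ := hcol_neg i j h
      exact ⟨j, l, hl⟩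
  choose r hr using fun j : J => j.2
  choose h' hh' using fun j : J => hrow_pos (r j) j (hr j)
  let h : J → J := fun j => ⟨h' j, hcol_neg (r j) (h' j) (hh' j)⟩
  let C : Finset J := (Function.periodicPts h).toFinset
  have hC : C.Nonempty := by
    obtain ⟨j⟩ := hJ
    -- two iterates of `h` at `j` coincide, and the earlier one is periodic
    obtain ⟨m, n, hmn, he⟩ := Finite.exists_ne_map_eq_of_infinite fun n : ℕ => h^[n] j
    wlog hlt : m < n generalizing m n
    · exact this n m hmn.symm he.symm (by omega)
    refine ⟨h^[m] j, Set.mem_toFinset.2 (Function.mk_mem_periodicPts (n := n - m) (by omega) ?_)⟩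
    change h^[n - m] (h^[m] j) = h^[m] j
    rw [← Function.iterate_add_apply, Nat.sub_add_cancel hlt.le]
    exact he.symm
  let e : J → ι × κ := fun j => (r j, j)
  let e' : J → ι × κ := fun j => (r j, h j)
  have hbij : Set.BijOn h C C := by
    rw [Set.coe_toFinset]
    exact Function.bijOn_periodicPts h
  have he : Set.InjOn e C := fun j _ k _ hjk => Subtype.ext (Prod.ext_iff.1 hjk).2
  have he' : Set.InjOn e' C := fun j hj k hk hjk =>
    hbij.injOn hj hk (Subtype.ext (Prod.ext_iff.1 hjk).2)
  have hval : ∀ j : J, M.value (r j) j / M.price b j = M.value (r j) (h j) / M.price b (h j) := by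
    intro j
    refine le_antisymm ?_ ?_
    · have := hc.ratio_le (r j) (h j) j ((bid_nonneg _ _).trans_lt (hh' j))
      rwa [hp] at this
    · exact hb.ratio_le (r j) j (h j) ((bid_nonneg _ _).trans_lt (hr j))
  have hprod : ∏ j ∈ C, M.value (r j) j = ∏ j ∈ C, M.value (r j) (h j) := by
    have h1 : ∏ j ∈ C, M.value (r j) j / M.price b j
        = ∏ j ∈ C, M.value (r j) (h j) / M.price b (h j) :=
      Finset.prod_congr rfl fun j _ => hval j
    have h2 : ∏ j ∈ C, M.price b (h j) = ∏ j ∈ C, M.price b j :=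
      Finset.prod_bij (fun j _ => h j) (fun j hj => hbij.mapsTo hj)
        (fun j hj k hk hjk => hbij.injOn hj hk hjk)
        (fun k hk => by
          obtain ⟨j, hj, hjk⟩ := hbij.surjOn hk
          exact ⟨j, hj, hjk⟩)
        (fun _ _ => rfl)
    rw [Finset.prod_div_distrib, Finset.prod_div_distrib, h2] at h1
    exact (div_left_inj' (Finset.prod_ne_zero_iff.2 fun (j : J) _ => (hb.price_pos j).ne')).1 h1
  refine hM (C.image e) (C.image e') (hC.image e) (hC.image e') ?_ ?_ ?_ ?_
  · intro heq
    obtain ⟨j, hj⟩ := hC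
    obtain ⟨k, _, hk⟩ := Finset.mem_image.1 (heq ▸ Finset.mem_image_of_mem e hj)
    have h1 : r k = r j := (Prod.ext_iff.1 hk).1
    have h2 : h' k = (j : κ) := (Prod.ext_iff.1 hk).2
    have h3 := hh' k
    rw [h1, h2] at h3
    exact absurd h3 (hr j).le.not_gt
  · intro x hx
    obtain ⟨j, _, rfl⟩ := Finset.mem_image.1 hx
    exact (hb.value_pos ((bid_nonneg _ _).trans_lt (hr j))).ne'
  · intro x hx
    obtain ⟨j, _, rfl⟩ := Finset.mem_image.1 hx
    exact (hc.value_pos ((bid_nonneg _ _).trans_lt (hh' j))).ne'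
  · rw [Finset.prod_image he, Finset.prod_image he']
    exact hprod

theorem IsBalanced.unique {M : FisherMarket ι κ} (hM : M.IsGeneric) {b c : M.BidProfile}
    (hb : M.IsBalanced b) (hc : M.IsBalanced c) : c = b :=
  hb.eq_of_price_eq hM hc (hb.price_eq hc.admissibleBid (hc.potential_le hb.admissibleBid))

/-! ### Moving a bid along a segment -/

/-- Bounds the gain of a move towards `y` from below by `θ` times the derivative at the endpoint
of the move, by concavity. -/
theorem le_payoff_blend_sub [DecidableEq ι] {M : FisherMarket ι κ} (b : M.BidProfile) (i : ι)
    (y : M.bidSet i) (θ : unitInterval) (hθ : (θ : ℝ) < 1) :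
    θ * (∑ j, (y.1 j - (b i).1 j) * Real.log (M.value i j)
        - ∑ j, (y.1 j - (b i).1 j) * Real.log (M.price b j + θ * (y.1 j - (b i).1 j)))
      ≤ M.payoff i (Function.update b i (blend θ y (b i))) - M.payoff i b := by
  have h1 : ∀ j, M.price (Function.update b i (blend θ y (b i))) j
      = M.price b j + θ * (y.1 j - (b i).1 j) := fun j => by
    rw [price_update]
    simp [blend]
  have h2 : M.payoff i (Function.update b i (blend θ y (b i))) - M.payoff i b
      = θ * ∑ j, (y.1 j - (b i).1 j) * Real.log (M.value i j)
        + ∑ j, (mulOneSubLog (M.price b j + θ * (y.1 j - (b i).1 j))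
          - mulOneSubLog (M.price b j)) := by
    simp only [payoff, h1, Function.update_self, Finset.mul_sum, Finset.sum_sub_distrib]
    have : ∑ j, (blend θ y (b i)).1 j * Real.log (M.value i j)
        = ∑ j, (b i).1 j * Real.log (M.value i j)
          + ∑ j, θ * ((y.1 j - (b i).1 j) * Real.log (M.value i j)) := by
      rw [← Finset.sum_add_distrib]
      refine Finset.sum_congr rfl fun j _ => ?_
      simp only [blend]
      ring
    linarith
  rw [h2, mul_sub, sub_eq_add_neg, Finset.mul_sum (f := fun j =>
    (y.1 j - (b i).1 j) * Real.log (M.price b j + θ * (y.1 j - (b i).1 j))),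
    ← Finset.sum_neg_distrib]
  refine add_le_add le_rfl (Finset.sum_le_sum fun j _ => ?_)
  have hp := bid_le_price b i j
  have hx := bid_nonneg (b i) j
  have hy := bid_nonneg y j
  have hθ0 := θ.2.1
  have hq : 0 ≤ M.price b j + θ * (y.1 j - (b i).1 j) := by
    rw [← h1]
    exact price_nonneg _ j
  rcases hq.eq_or_lt with h0 | h0
  · -- the new price vanishes only if the old one does and buyer `i` never bids on `j`
    have hx0 : (b i).1 j = 0 := by
      nlinarith [mul_nonneg hθ0 hy, mul_nonneg (sub_nonneg.2 hθ.le) hx]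
    have hp0 : M.price b j = 0 := by
      nlinarith [mul_nonneg hθ0 hy, price_nonneg b j]
    rw [← h0, hp0]
    simp
  · have := mulOneSubLog_sub_le h0 (price_nonneg b j)
    linarith

/-! ### Existence of a balanced profile -/

/-- The first-order condition at a maximizer of the potential, before passing to the limit
`t → 0`; the prices may vanish there. -/
theorem sum_mul_log_value_le_of_isMax {M : FisherMarket ι κ} {b : M.BidProfile}
    (hb : ∀ i, M.AdmissibleBid i (b i))
    (hmax : ∀ c : M.BidProfile, (∀ i, M.AdmissibleBid i (c i)) → M.potential c ≤ M.potential b)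
    {i : ι} {y : M.bidSet i} (hy : M.AdmissibleBid i y) {t : ℝ} (ht : t ∈ Set.Ioo (0 : ℝ) 1) :
    ∑ j, (y.1 j - (b i).1 j) * Real.log (M.value i j)
      ≤ ∑ j, (y.1 j - (b i).1 j) * Real.log (M.price b j + t * (y.1 j - (b i).1 j)) := by
  classical
  let θ : unitInterval := ⟨t, ht.1.le, ht.2.le⟩
  have h1 := le_payoff_blend_sub b i y θ ht.2
  have h2 := hmax (Function.update b i (blend θ y (b i))) fun l => by
    by_cases h : l = i
    · subst h
      simpa using hy.blend θ (hb l)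
    · simpa [h] using hb l
  have h3 := potential_update_sub b i (blend θ y (b i))
  have h4 : t * (∑ j, (y.1 j - (b i).1 j) * Real.log (M.value i j)
      - ∑ j, (y.1 j - (b i).1 j) * Real.log (M.price b j + t * (y.1 j - (b i).1 j))) ≤ 0 :=
    h1.trans (by linarith)
  exact sub_nonpos.1 (nonpos_of_mul_nonpos_right h4 ht.1)

theorem price_pos_of_isMax {M : FisherMarket ι κ} {b : M.BidProfile}
    (hb : ∀ i, M.AdmissibleBid i (b i))
    (hmax : ∀ c : M.BidProfile, (∀ i, M.AdmissibleBid i (c i)) → M.potential c ≤ M.potential b)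
    (k : κ) : 0 < M.price b k := by
  classical
  refine (price_nonneg b k).lt_of_ne' fun hk => ?_
  obtain ⟨i, hi⟩ := M.good_valued k
  have hy := admissibleBid_singleBid (M := M) hi.ne'
  set y := M.singleBid i k
  have hbk : ∀ j, M.price b j = 0 → (b i).1 j = 0 := fun j hj =>
    le_antisymm (hj ▸ bid_le_price b i j) (bid_nonneg _ _)
  let f : κ → ℝ → ℝ := fun j t =>
    (y.1 j - (b i).1 j) * Real.log (M.price b j + t * (y.1 j - (b i).1 j))
  -- the summand of the good `k` tends to `-∞` and the others stay bounded above
  have hf : ∀ j, ∃ C : ℝ, ∀ᶠ t in 𝓝[>] (0 : ℝ), f j t ≤ C := by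
    intro j
    rcases (price_nonneg b j).eq_or_lt with hj | hj
    · refine ⟨0, ?_⟩
      have h1 : ∀ᶠ t in 𝓝 (0 : ℝ), t * y.1 j < 1 :=
        (continuous_id.mul continuous_const).tendsto' 0 0 (by simp) |>.eventually_lt_const
          one_pos
      filter_upwards [nhdsWithin_le_nhds h1, self_mem_nhdsWithin] with t ht ht0
      simp only [f, ← hj, hbk j hj.symm, sub_zero, zero_add]
      exact mul_nonpos_of_nonneg_of_nonpos (bid_nonneg y j)
        (Real.log_nonpos (mul_nonneg (le_of_lt ht0) (bid_nonneg y j)) ht.le)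
    · have h1 : ContinuousAt (f j) 0 := by
        refine continuousAt_const.mul (ContinuousAt.log (by fun_prop) ?_)
        simpa using hj.ne'
      exact ⟨f j 0 + 1, nhdsWithin_le_nhds
        ((h1.eventually_lt_const (lt_add_one _)).mono fun t ht => ht.le)⟩
  choose C hC using hf
  have hy_k : y.1 k = M.budget i := by simp [y, singleBid]
  have hlim : Tendsto (f k) (𝓝[>] 0) atBot := by
    have h1 : f k = fun t => M.budget i * Real.log (t * M.budget i) := by
      funext t
      simp [f, hk, hbk k hk, hy_k]
    rw [h1]
    refine Tendsto.const_mul_atBot (M.budget_pos i) (Real.tendsto_log_nhdsGT_zero.comp ?_)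
    refine tendsto_nhdsWithin_iff.2 ⟨?_, ?_⟩
    · exact ((continuous_id.mul continuous_const).tendsto' 0 0 (by simp)).mono_left
        nhdsWithin_le_nhds
    · filter_upwards [self_mem_nhdsWithin] with t ht
      exact mul_pos ht (M.budget_pos i)
  set A := ∑ j, (y.1 j - (b i).1 j) * Real.log (M.value i j)
  have h1 : ∀ᶠ t in 𝓝[>] (0 : ℝ), t < 1 :=
    nhdsWithin_le_nhds (eventually_lt_nhds one_pos)
  have h0 : ∀ᶠ t in 𝓝[>] (0 : ℝ), 0 < t := self_mem_nhdsWithin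
  obtain ⟨t, ht, ht0, ht1, htk⟩ := ((eventually_all.2 hC).and (h0.and
    (h1.and (hlim.eventually_lt_atBot (A - ∑ j ∈ Finset.univ.erase k, C j))))).exists
  have h2 : A ≤ ∑ j, f j t := sum_mul_log_value_le_of_isMax hb hmax hy ⟨ht0, ht1⟩
  rw [← Finset.add_sum_erase _ _ (Finset.mem_univ k)] at h2
  have h3 := Finset.sum_le_sum fun j (_ : j ∈ Finset.univ.erase k) => ht j
  linarith

theorem isBalanced_of_isMax {M : FisherMarket ι κ} {b : M.BidProfile}
    (hb : ∀ i, M.AdmissibleBid i (b i))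
    (hmax : ∀ c : M.BidProfile, (∀ i, M.AdmissibleBid i (c i)) → M.potential c ≤ M.potential b) :
    M.IsBalanced b := by
  classical
  have hp := price_pos_of_isMax hb hmax
  refine ⟨hp, fun i j k hj => ?_⟩
  rcases (M.value_nonneg i k).eq_or_lt with hk | hk
  · rw [← hk, zero_div]
    exact div_nonneg (M.value_nonneg i j) (hp j).le
  have hv : ∀ l, 0 < (b i).1 l → 0 < M.value i l := fun l hl =>
    (M.value_nonneg i l).lt_of_ne' fun h => hl.ne' (hb i l h)
  have h1 : Real.log (M.value i k) - Real.log (M.price b k)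
      ≤ Real.log (M.value i j) - Real.log (M.price b j) := by
    refine le_of_mul_le_sum_mul
      (w := fun j => Real.log (M.value i j) - Real.log (M.price b j)) (b := (b i).1)
      (S := {l | 0 < M.value i l}) (bid_nonneg (b i)) hv (sum_bid (b i)) ?_ hj hk
    intro l hl
    set y := M.singleBid i l with hy
    have h2 : Tendsto (fun t => ∑ j, (y.1 j - (b i).1 j)
        * Real.log (M.price b j + t * (y.1 j - (b i).1 j))) (𝓝[>] 0)
        (𝓝 (∑ j, (y.1 j - (b i).1 j) * Real.log (M.price b j))) := by
      refine tendsto_finsetSum _ fun j _ => ?_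
      have h3 : ContinuousAt (fun t => (y.1 j - (b i).1 j)
          * Real.log (M.price b j + t * (y.1 j - (b i).1 j))) 0 := by
        refine continuousAt_const.mul (ContinuousAt.log (by fun_prop) ?_)
        simpa using (hp j).ne'
      simpa using h3.tendsto.mono_left (nhdsWithin_le_nhds (s := Set.Ioi 0))
    have h4 : ∑ j, (y.1 j - (b i).1 j) * Real.log (M.value i j)
        ≤ ∑ j, (y.1 j - (b i).1 j) * Real.log (M.price b j) := by
      refine ge_of_tendsto h2 ?_
      filter_upwards [self_mem_nhdsWithin, nhdsWithin_le_nhds (eventually_lt_nhds one_pos)]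
        with t ht0 ht1
      exact sum_mul_log_value_le_of_isMax hb hmax (admissibleBid_singleBid (ne_of_gt hl))
        ⟨ht0, ht1⟩
    have h5 : ∀ w : κ → ℝ, ∑ j, y.1 j * w j = M.budget i * w l := fun w => by
      simp [hy, singleBid]
    simp only [sub_mul, Finset.sum_sub_distrib, h5] at h4
    simp only [mul_sub, Finset.sum_sub_distrib]
    linarith
  rw [← Real.log_div hk.ne' (hp k).ne', ← Real.log_div (hv j hj).ne' (hp j).ne'] at h1
  exact (Real.log_le_log_iff (div_pos hk (hp k)) (div_pos (hv j hj) (hp j))).1 h1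

theorem exists_isBalanced (M : FisherMarket ι κ) : ∃ b : M.BidProfile, M.IsBalanced b := by
  choose k hk using M.buyer_interested
  obtain ⟨b, hb, hmax⟩ := M.isClosed_admissible.isCompact.exists_isMaxOn
    ⟨fun i => M.singleBid i (k i), fun i => admissibleBid_singleBid (hk i).ne'⟩
    M.continuous_potential.continuousOn
  exact ⟨b, isBalanced_of_isMax hb fun c hc => hmax hc⟩

/-! ### The joint gain of small moves towards a profile -/

/-- If every player moves on its own a small fraction `θ` of the way towards `c`, the sum of the
gains is, up to an error `θ * γ` uniform in the profile, at least `θ` times the difference of the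
potentials. In the limit `θ → 0` this is the gradient inequality of the concave potential, whose
gradient is infinite where a price vanishes. -/
theorem exists_le_sum_payoff_blend_sub [DecidableEq ι] (M : FisherMarket ι κ) (c : M.BidProfile)
    {γ : ℝ} (hγ : 0 < γ) :
    ∃ θ : unitInterval, 0 < (θ : ℝ) ∧ ∀ b : M.BidProfile,
      θ * (M.potential c - M.potential b - γ)
        ≤ ∑ i, (M.payoff i (Function.update b i (blend θ (c i) (b i))) - M.payoff i b) := by
  set B := ∑ i, M.budget i with hB
  have hB0 : 0 ≤ B := Finset.sum_nonneg fun i _ => (M.budget_pos i).le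
  have hiB : ∀ i, M.budget i ≤ B := fun i =>
    Finset.single_le_sum (f := M.budget) (fun i _ => (M.budget_pos i).le) (Finset.mem_univ i)
  set n : ℝ := (Fintype.card ι : ℝ) with hn
  set m : ℝ := (Fintype.card κ : ℝ) with hm
  have hn0 : 0 ≤ n := Nat.cast_nonneg _
  have hm0 : 0 ≤ m := Nat.cast_nonneg _
  set ε := γ / (4 * (m + 1)) with hε
  have hε0 : 0 < ε := by positivity
  have hmε : m * ε ≤ γ / 4 := by
    rw [hε, mul_div_assoc', div_le_div_iff₀ (by positivity) (by positivity)]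
    nlinarith
  obtain ⟨η, hη, huc⟩ := Metric.uniformContinuousOn_iff.1
    ((isCompact_Icc (a := (0 : ℝ)) (b := 2 * B)).uniformContinuousOn_of_continuous
      continuous_mulOneSubLog.continuousOn) ε hε0
  -- `θ` is so small that a shift of the prices by `θ * B` costs at most `ε` per good, and the
  -- error `4 * θ * B` per pair of buyer and good adds up to at most `γ / 2`
  obtain ⟨t, ht0, ht⟩ : ∃ t : ℝ, 0 < t ∧ t ≤ 1 / 2 ∧ t * B < η ∧ m * (n * (4 * t * B)) ≤ γ / 2 := by
    refine ⟨min (1 / 2) (min (η / (B + 1)) (γ / (8 * (m * n * B + 1)))), by positivity,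
      min_le_left _ _, ?_, ?_⟩
    · calc _ ≤ η / (B + 1) * B :=
            mul_le_mul_of_nonneg_right ((min_le_right _ _).trans (min_le_left _ _)) hB0
        _ < η := by
            rw [div_mul_eq_mul_div, div_lt_iff₀ (by positivity)]
            nlinarith
    · calc _ = 4 * (m * n * B) * min (1 / 2) (min (η / (B + 1)) (γ / (8 * (m * n * B + 1)))) := by
            ring
        _ ≤ 4 * (m * n * B) * (γ / (8 * (m * n * B + 1))) :=
            mul_le_mul_of_nonneg_left ((min_le_right _ _).trans (min_le_right _ _))
              (by positivity)
        _ ≤ γ / 2 := by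
            rw [mul_div_assoc', div_le_div_iff₀ (by positivity) (by positivity)]
            nlinarith [show 0 ≤ m * n * B by positivity]
  obtain ⟨ht2, htη, htγ⟩ := ht
  have hshift : ∀ (b : M.BidProfile) (j : κ),
      |mulOneSubLog (M.price b j + t * B) - mulOneSubLog (M.price b j)| ≤ ε := by
    intro b j
    have h1 := price_nonneg b j
    have h2 := price_le_sum_budget b j
    have h3 : 0 ≤ t * B := by positivity
    have h4 : t * B ≤ B := by nlinarith
    refine (huc _ ⟨by linarith, by linarith⟩ _ ⟨h1, by linarith⟩ ?_).le
    rw [Real.dist_eq, add_sub_cancel_left, abs_of_nonneg h3]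
    exact htη
  refine ⟨⟨t, ht0.le, by linarith⟩, ht0, fun b => ?_⟩
  set θ : unitInterval := ⟨t, ht0.le, by linarith⟩
  have hsum := Finset.sum_le_sum fun i (_ : i ∈ Finset.univ) =>
    le_payoff_blend_sub b i (c i) θ (by change t < 1; linarith)
  refine le_trans ?_ hsum
  rw [← Finset.mul_sum, Finset.sum_sub_distrib]
  refine mul_le_mul_of_nonneg_left ?_ ht0.le
  have hlog : ∀ i j, ((c i).1 j - (b i).1 j)
      * Real.log (M.price b j + t * ((c i).1 j - (b i).1 j))
      ≤ ((c i).1 j - (b i).1 j) * Real.log (M.price b j + t * B) + 4 * t * B := fun i j =>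
    mul_log_add_le (bid_nonneg _ _) (bid_le_price b i j) (price_le_sum_budget b j)
      (bid_nonneg _ _) ((bid_le_budget _ _).trans (hiB i)) ht0 ht2
  have h1 : ∑ i, ∑ j, ((c i).1 j - (b i).1 j)
      * Real.log (M.price b j + t * ((c i).1 j - (b i).1 j))
      ≤ ∑ j, (M.price c j - M.price b j) * Real.log (M.price b j + t * B)
        + m * (n * (4 * t * B)) := by
    rw [sum_price_sub_mul b c]
    calc _ ≤ ∑ i, ∑ j, (((c i).1 j - (b i).1 j) * Real.log (M.price b j + t * B)
          + 4 * t * B) := Finset.sum_le_sum fun i _ => Finset.sum_le_sum fun j _ => hlog i j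
      _ = _ := by
        simp only [Finset.sum_add_distrib, Finset.sum_const, Finset.card_univ, nsmul_eq_mul]
        rw [hn, hm]
        ring
  have h2 : ∀ j, mulOneSubLog (M.price c j) - mulOneSubLog (M.price b j) - 2 * ε
      ≤ -((M.price c j - M.price b j) * Real.log (M.price b j + t * B)) := by
    intro j
    have hcB : 0 ≤ M.price c j + t * B := add_nonneg (price_nonneg c j) (by positivity)
    have h3 := abs_le.1 (hshift b j)
    have h4 := abs_le.1 (hshift c j)
    rcases (add_nonneg (price_nonneg b j) (by positivity : 0 ≤ t * B)).eq_or_lt with h0 | h0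
    · -- all prices vanish if there are no buyers
      have hb0 : M.price b j = 0 := by
        have : 0 ≤ t * B := by positivity
        linarith [price_nonneg b j]
      have hB' : B = 0 := by
        have : t * B = 0 := by linarith
        exact (mul_eq_zero.1 this).resolve_left ht0.ne'
      have hc0 : M.price c j = 0 :=
        le_antisymm (hB' ▸ price_le_sum_budget c j) (price_nonneg c j)
      rw [hb0, hc0]
      simp [hε0.le]
    · have h5 := mulOneSubLog_sub_le h0 hcB
      linarith [h3.1, h3.2, h4.1, h4.2]
  have h3 := Finset.sum_le_sum fun j (_ : j ∈ Finset.univ) => h2 j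
  simp only [Finset.sum_neg_distrib, Finset.sum_sub_distrib (g := fun _ => 2 * ε),
    Finset.sum_const, Finset.card_univ, nsmul_eq_mul] at h3
  have h4 := potential_sub b c
  change _ ≤ _ - ∑ i, ∑ j, ((c i).1 j - (b i).1 j)
      * Real.log (M.price b j + t * ((c i).1 j - (b i).1 j))
  linarith

/-! ### Extended-real expectations -/

theorem expectation_eq_integral {Ω : Type*} [MeasurableSpace Ω] {μ : ProbabilityMeasure Ω}
    {f : Ω → EReal} {h : Ω → ℝ} (hh : Integrable h (μ : Measure Ω))
    (hf : ∀ᵐ ω ∂(μ : Measure Ω), f ω = h ω) :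
    expectation μ f = ((∫ ω, h ω ∂(μ : Measure Ω) : ℝ) : EReal) := by
  have h1 : ∫⁻ ω, (f ω).toENNReal ∂(μ : Measure Ω)
      = ∫⁻ ω, ENNReal.ofReal (h ω) ∂(μ : Measure Ω) :=
    lintegral_congr_ae (hf.mono fun ω hω => by simp [hω])
  have h2 : ∫⁻ ω, (-f ω).toENNReal ∂(μ : Measure Ω)
      = ∫⁻ ω, ENNReal.ofReal (-h ω) ∂(μ : Measure Ω) :=
    lintegral_congr_ae (hf.mono fun ω hω => by simp [hω, ← EReal.coe_neg])
  have h3 : ∫⁻ ω, ENNReal.ofReal (h ω) ∂(μ : Measure Ω) ≠ ⊤ := hh.lintegral_lt_top.ne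
  have h4 : ∫⁻ ω, ENNReal.ofReal (-h ω) ∂(μ : Measure Ω) ≠ ⊤ := hh.neg.lintegral_lt_top.ne
  rw [expectation, h1, h2, integral_eq_lintegral_pos_part_sub_lintegral_neg_part hh,
    EReal.coe_sub, EReal.coe_ennreal_toReal h3, EReal.coe_ennreal_toReal h4]

theorem expectation_eq_bot {Ω : Type*} [MeasurableSpace Ω] {μ : ProbabilityMeasure Ω}
    {f : Ω → EReal} {s : Set Ω} (hs : MeasurableSet s) (hμ : (μ : Measure Ω) s ≠ 0)
    (hf : ∀ ω ∈ s, f ω = ⊥) : expectation μ f = ⊥ := by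
  have h1 : ∫⁻ ω, (-f ω).toENNReal ∂(μ : Measure Ω) = ⊤ := by
    rw [eq_top_iff]
    calc (⊤ : ENNReal) = ⊤ * (μ : Measure Ω) s := (ENNReal.top_mul hμ).symm
      _ = ∫⁻ ω, s.indicator (fun _ => ⊤) ω ∂(μ : Measure Ω) :=
          (lintegral_indicator_const hs _).symm
      _ ≤ _ := lintegral_mono fun ω => by
          by_cases hω : ω ∈ s
          · simp [hω, hf ω hω]
          · simp [hω]
  rw [expectation, h1, EReal.coe_ennreal_top, sub_eq_add_neg, EReal.neg_top, EReal.add_bot]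

theorem expectation_diracProba {Ω : Type*} [MeasurableSpace Ω] [MeasurableSingletonClass Ω]
    (a : Ω) (f : Ω → EReal) : expectation (diracProba a) f = f a := by
  have h : ((diracProba a : ProbabilityMeasure Ω) : Measure Ω) = Measure.dirac a := rfl
  rw [expectation, h, lintegral_dirac, lintegral_dirac]
  rcases le_total 0 (f a) with h0 | h0
  · rw [EReal.coe_toENNReal h0, EReal.toENNReal_of_nonpos (x := -f a) (by simpa using h0)]
    simp
  · rw [EReal.toENNReal_of_nonpos h0, EReal.coe_toENNReal (x := -f a) (by simpa using h0)]
    simp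

theorem integral_empirical {Ω : Type*} [MeasurableSpace Ω] (P : ℕ → ProbabilityMeasure Ω) (T : ℕ)
    {f : Ω → ℝ} (hf : ∀ t, Integrable f (P t : Measure Ω)) :
    ∫ ω, f ω ∂(empirical P T : Measure Ω)
      = ((T + 1 : ℕ) : ℝ)⁻¹ * ∑ t ∈ Finset.range (T + 1), ∫ ω, f ω ∂(P t : Measure Ω) := by
  change ∫ ω, f ω ∂(((T + 1 : ℕ) : ENNReal)⁻¹ • ∑ t ∈ Finset.range (T + 1), (P t : Measure Ω)) = _
  rw [integral_smul_measure, integral_finsetSum_measure fun t _ => hf t, ENNReal.toReal_inv,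
    ENNReal.toReal_natCast, smul_eq_mul]

theorem assocUtility_eq_coe {M : FisherMarket ι κ} {i : ι} {b : M.BidProfile}
    (hb : M.AdmissibleBid i (b i)) : M.assocUtility i b = (M.payoff i b : EReal) := by
  have h : ∀ j, ((b i).1 j : EReal) * ENNReal.log (ENNReal.ofReal (M.value i j))
      = (((b i).1 j * Real.log (M.value i j) : ℝ) : EReal) := fun j => by
    rcases (M.value_nonneg i j).eq_or_lt with hj | hj
    · simp [hb j hj.symm]
    · rw [ENNReal.log_ofReal_of_pos hj, EReal.coe_mul]
  rw [payoff, EReal.coe_add, EReal.coe_finset_sum]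
  simp only [assocUtility, h]
  rfl

theorem assocUtility_eq_bot {M : FisherMarket ι κ} {i : ι} {b : M.BidProfile}
    (hb : ¬ M.AdmissibleBid i (b i)) : M.assocUtility i b = ⊥ := by
  simp only [AdmissibleBid, not_forall] at hb
  obtain ⟨j, hj, hbj⟩ := hb
  have h : ((b i).1 j : EReal) * ENNReal.log (ENNReal.ofReal (M.value i j)) = ⊥ := by
    rw [hj, ENNReal.ofReal_zero, ENNReal.log_zero]
    exact EReal.coe_mul_bot_of_pos ((bid_nonneg _ j).lt_of_ne' hbj)
  rw [assocUtility, EReal.finset_sum_eq_bot (Finset.mem_univ j) h, EReal.bot_add]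

theorem integrable_of_continuous {M : FisherMarket ι κ} (μ : ProbabilityMeasure M.BidProfile)
    {f : M.BidProfile → ℝ} (hf : Continuous f) : Integrable f (μ : Measure M.BidProfile) :=
  hf.integrable_of_hasCompactSupport (HasCompactSupport.of_compactSpace f)

/-! ### No-swap-regret dynamics -/

section Regret

variable [DecidableEq ι] {M : FisherMarket ι κ} {P : ℕ → ProbabilityMeasure M.BidProfile}

theorem expectation_swap (μ : ProbabilityMeasure M.BidProfile) (i : ι)
    {φ : M.bidSet i → M.bidSet i} (hφ : Continuous φ)
    (h : ∀ᵐ b ∂(μ : Measure M.BidProfile), M.AdmissibleBid i (φ (b i))) :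
    expectation μ (fun b => M.assocUtility i (M.swap i φ b))
      = ((∫ b, M.payoff i (M.swap i φ b) ∂(μ : Measure M.BidProfile) : ℝ) : EReal) :=
  expectation_eq_integral
    (integrable_of_continuous μ ((M.continuous_payoff i).comp (continuous_swap i hφ)))
    (h.mono fun b hb => assocUtility_eq_coe (by simpa [swap] using hb))

/-- Inadmissible bids have utility `-∞`, so playing them with positive probability even once would
cause infinite regret towards a constant admissible bid. -/
theorem NoSwapRegret.ae_admissibleBid (hP : M.NoSwapRegret P) (t : ℕ) (i : ι) :
    ∀ᵐ b ∂(P t : Measure M.BidProfile), M.AdmissibleBid i (b i) := by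
  by_contra hne
  obtain ⟨k, hk⟩ := M.buyer_interested i
  have hy := admissibleBid_singleBid hk.ne'
  have hclosed : IsClosed {b : M.BidProfile | M.AdmissibleBid i (b i)} := by
    simp only [AdmissibleBid, Set.ofPred_forall]
    exact isClosed_iInter fun j => isClosed_iInter fun _ =>
      isClosed_eq (continuous_bid i j) continuous_const
  have hbot : expectation (P t) (M.assocUtility i) = ⊥ :=
    expectation_eq_bot hclosed.measurableSet.compl hne fun b hb => assocUtility_eq_bot hb
  obtain ⟨T, hT, htT⟩ := ((hP i (fun _ => M.singleBid i k) measurable_const 1 one_pos).and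
    (eventually_gt_atTop t)).exists
  simp only [expectation_swap (P _) i continuous_const (Eventually.of_forall fun _ => hy)] at hT
  rw [EReal.finset_sum_eq_bot (f := fun t => expectation (P t) (M.assocUtility i))
    (Finset.mem_range.2 htT) hbot, EReal.bot_add, ← EReal.coe_finset_sum] at hT
  exact EReal.coe_ne_bot _ (le_bot_iff.1 hT)

theorem NoSwapRegret.eventually_sum_integral_le (hP : M.NoSwapRegret P) (i : ι)
    {φ : M.bidSet i → M.bidSet i} (hφ : Continuous φ)
    (hadm : ∀ x, M.AdmissibleBid i x → M.AdmissibleBid i (φ x)) {ε : ℝ} (hε : 0 < ε) :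
    ∀ᶠ T : ℕ in atTop, ∑ t ∈ Finset.range T,
      ∫ b, (M.payoff i (M.swap i φ b) - M.payoff i b) ∂(P t : Measure M.BidProfile) ≤ ε * T := by
  filter_upwards [hP i φ hφ.measurable ε hε] with T hT
  have h1 : ∀ t, expectation (P t) (M.assocUtility i)
      = ((∫ b, M.payoff i b ∂(P t : Measure M.BidProfile) : ℝ) : EReal) := fun t =>
    expectation_eq_integral (integrable_of_continuous _ (M.continuous_payoff i))
      ((hP.ae_admissibleBid t i).mono fun b hb => assocUtility_eq_coe hb)
  simp only [h1, expectation_swap (P _) i hφ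
    ((hP.ae_admissibleBid _ i).mono fun b hb => hadm _ hb), ← EReal.coe_finset_sum,
    ← EReal.coe_add, EReal.coe_le_coe_iff] at hT
  have h2 : ∀ t, ∫ b, (M.payoff i (M.swap i φ b) - M.payoff i b) ∂(P t : Measure M.BidProfile)
      = ∫ b, M.payoff i (M.swap i φ b) ∂(P t : Measure M.BidProfile)
        - ∫ b, M.payoff i b ∂(P t : Measure M.BidProfile) := fun t =>
    integral_sub
      (integrable_of_continuous _ ((M.continuous_payoff i).comp (continuous_swap i hφ)))
      (integrable_of_continuous _ (M.continuous_payoff i))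
  simp only [h2, Finset.sum_sub_distrib]
  linarith

/-- Without swap regret the time average of the expected potential is asymptotically at least the
potential of any admissible profile `c`: the players do not regret not having moved towards `c`. -/
theorem NoSwapRegret.eventually_sum_integral_potential_le (hP : M.NoSwapRegret P)
    {c : M.BidProfile} (hc : ∀ i, M.AdmissibleBid i (c i)) {γ : ℝ} (hγ : 0 < γ) :
    ∀ᶠ T : ℕ in atTop, ∑ t ∈ Finset.range T,
      ∫ b, (M.potential c - M.potential b) ∂(P t : Measure M.BidProfile) ≤ γ * T := by
  obtain ⟨θ, hθ, hgain⟩ := M.exists_le_sum_payoff_blend_sub c (half_pos hγ)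
  set n : ℝ := (Fintype.card ι : ℝ) with hn
  have hn0 : 0 ≤ n := Nat.cast_nonneg _
  have hev : ∀ᶠ T : ℕ in atTop, ∀ i, ∑ t ∈ Finset.range T,
      ∫ b, (M.payoff i (M.swap i (blend θ (c i)) b) - M.payoff i b)
        ∂(P t : Measure M.BidProfile) ≤ θ * γ / (2 * (n + 1)) * T :=
    eventually_all.2 fun i => hP.eventually_sum_integral_le i (continuous_blend θ (c i))
      (fun x hx => (hc i).blend θ hx) (by positivity)
  filter_upwards [hev] with T hT
  have hint : ∀ t, θ * (∫ b, (M.potential c - M.potential b) ∂(P t : Measure M.BidProfile) - γ / 2)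
      ≤ ∑ i, ∫ b, (M.payoff i (M.swap i (blend θ (c i)) b) - M.payoff i b)
        ∂(P t : Measure M.BidProfile) := by
    intro t
    have hi : ∀ i, Continuous fun b =>
        M.payoff i (M.swap i (blend θ (c i)) b) - M.payoff i b := fun i =>
      ((M.continuous_payoff i).comp (continuous_swap i (continuous_blend θ (c i)))).sub
        (M.continuous_payoff i)
    have hd : Continuous fun b => M.potential c - M.potential b :=
      continuous_const.sub M.continuous_potential
    have h1 : θ * (∫ b, (M.potential c - M.potential b) ∂(P t : Measure M.BidProfile) - γ / 2)
        = ∫ b, θ * (M.potential c - M.potential b - γ / 2) ∂(P t : Measure M.BidProfile) := by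
      rw [integral_const_mul, integral_sub (integrable_of_continuous _ hd) (integrable_const _)]
      simp
    rw [h1, ← integral_finsetSum _ fun i _ => integrable_of_continuous _ (hi i)]
    exact integral_mono
      (integrable_of_continuous _ (continuous_const.mul (hd.sub continuous_const)))
      (integrable_of_continuous _ (continuous_finsetSum _ fun i _ => hi i)) hgain
  have h1 := Finset.sum_le_sum fun t (_ : t ∈ Finset.range T) => hint t
  rw [Finset.sum_comm] at h1
  have h2 := h1.trans (Finset.sum_le_sum fun i (_ : i ∈ Finset.univ) => hT i)
  simp only [← Finset.mul_sum, Finset.sum_sub_distrib, Finset.sum_const, Finset.card_univ,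
    Finset.card_range, nsmul_eq_mul, ← hn] at h2
  have h3 : θ * γ / (2 * (n + 1)) * (n * T) ≤ θ * (γ / 2 * T) := by
    have h4 : n / (n + 1) ≤ 1 := (div_le_one (by positivity)).2 (by linarith)
    calc _ = n / (n + 1) * (θ * (γ / 2 * T)) := by field_simp
      _ ≤ 1 * (θ * (γ / 2 * T)) := mul_le_mul_of_nonneg_right h4 (by positivity)
      _ = _ := one_mul _
  have h5 := le_of_mul_le_mul_left (h2.trans h3) hθ
  linarith

end Regret

theorem NoSwapRegret.tendsto_empirical [DecidableEq ι] {M : FisherMarket ι κ}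
    {P : ℕ → ProbabilityMeasure M.BidProfile} (hP : M.NoSwapRegret P) {c : M.BidProfile}
    (hc : ∀ i, M.AdmissibleBid i (c i))
    (hmax : ∀ b : M.BidProfile, (∀ i, M.AdmissibleBid i (b i)) → b ≠ c →
      M.potential b < M.potential c) :
    Tendsto (empirical P) atTop (𝓝 (diracProba c)) := by
  rw [ProbabilityMeasure.tendsto_iff_forall_integral_tendsto]
  intro f
  have hdirac : ∫ b, f b ∂((diracProba c : ProbabilityMeasure M.BidProfile) : Measure _) = f c :=
    integral_dirac _ _
  rw [hdirac, Metric.tendsto_atTop']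
  intro ε hε
  obtain ⟨C, hC0, hC⟩ := exists_abs_sub_le_of_unique_max M.isClosed_admissible.isCompact
    M.continuous_potential f.continuous hmax (half_pos hε)
  obtain ⟨T₀, hT₀⟩ := eventually_atTop.1 (hP.eventually_sum_integral_potential_le hc
    (show 0 < ε / (4 * (C + 1)) by positivity))
  refine ⟨T₀, fun T hT => ?_⟩
  have hd : Continuous fun b => M.potential c - M.potential b :=
    continuous_const.sub M.continuous_potential
  have hfi : ∀ t, Integrable f (P t : Measure M.BidProfile) := fun t =>
    integrable_of_continuous _ f.continuous
  have h1 : ∀ t, |∫ b, f b ∂(P t : Measure M.BidProfile) - f c|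
      ≤ ε / 2 + C * ∫ b, (M.potential c - M.potential b) ∂(P t : Measure M.BidProfile) := by
    intro t
    have h2 : ∫ b, f b ∂(P t : Measure M.BidProfile) - f c
        = ∫ b, (f b - f c) ∂(P t : Measure M.BidProfile) := by
      rw [integral_sub (hfi t) (integrable_const _)]
      simp
    have h3 : ε / 2 + C * ∫ b, (M.potential c - M.potential b) ∂(P t : Measure M.BidProfile)
        = ∫ b, (ε / 2 + C * (M.potential c - M.potential b)) ∂(P t : Measure M.BidProfile) := by
      rw [integral_add (integrable_const _)
        ((integrable_of_continuous _ hd).const_mul C), integral_const_mul]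
      simp
    rw [h2, h3, ← Real.norm_eq_abs]
    refine norm_integral_le_of_norm_le
      (integrable_of_continuous _ (continuous_const.add (continuous_const.mul hd))) ?_
    filter_upwards [eventually_all.2 fun i => hP.ae_admissibleBid t i] with b hb
    exact hC b hb
  have hT1 : (0 : ℝ) < ((T + 1 : ℕ) : ℝ) := by positivity
  have h2 : ∫ b, f b ∂(empirical P T : Measure M.BidProfile) - f c
      = ((T + 1 : ℕ) : ℝ)⁻¹
        * ∑ t ∈ Finset.range (T + 1), (∫ b, f b ∂(P t : Measure M.BidProfile) - f c) := by
    rw [integral_empirical P T hfi, Finset.sum_sub_distrib, mul_sub, Finset.sum_const,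
      Finset.card_range, nsmul_eq_mul, inv_mul_cancel_left₀ hT1.ne']
  have h3 : C * (ε / (4 * (C + 1))) ≤ ε / 4 := by
    rw [mul_div_assoc', div_le_div_iff₀ (by positivity) (by positivity)]
    nlinarith
  have h4 := Finset.sum_le_sum fun t (_ : t ∈ Finset.range (T + 1)) => h1 t
  rw [Finset.sum_add_distrib, Finset.sum_const, Finset.card_range, nsmul_eq_mul,
    ← Finset.mul_sum] at h4
  have h5 := mul_le_mul_of_nonneg_left (hT₀ (T + 1) (by omega)) hC0
  rw [Real.dist_eq, h2, abs_mul, abs_of_pos (inv_pos.2 hT1), inv_mul_lt_iff₀ hT1]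
  have h6 := Finset.abs_sum_le_sum_abs
    (fun t => ∫ b, f b ∂(P t : Measure M.BidProfile) - f c) (Finset.range (T + 1))
  have h7 := mul_le_mul_of_nonneg_right h3 hT1.le
  have h8 := mul_pos hT1 hε
  linarith

/-! ### Correlated equilibria -/

theorem IsBalanced.isCorrelatedEquilibrium_diracProba [DecidableEq ι] {M : FisherMarket ι κ}
    {b : M.BidProfile} (hb : M.IsBalanced b) : M.IsCorrelatedEquilibrium (diracProba b) := by
  intro i φ _
  rw [expectation_diracProba, expectation_diracProba]
  by_cases h : M.AdmissibleBid i (φ (b i))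
  · rw [assocUtility_eq_coe (hb.admissibleBid i),
      assocUtility_eq_coe (b := M.swap i φ b) (by simpa [swap] using h), EReal.coe_le_coe_iff]
    have h1 := hb.potential_le (c := M.swap i φ b) fun l => by
      by_cases hl : l = i
      · subst hl
        simpa [swap] using h
      · simpa [swap, hl] using hb.admissibleBid l
    have h2 := potential_update_sub b i (φ (b i))
    unfold swap at h1 ⊢
    linarith
  · rw [assocUtility_eq_bot (b := M.swap i φ b) (by simpa [swap] using h)]
    exact bot_le

theorem IsCorrelatedEquilibrium.noSwapRegret [DecidableEq ι] {M : FisherMarket ι κ}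
    {μ : ProbabilityMeasure M.BidProfile} (hμ : M.IsCorrelatedEquilibrium μ) :
    M.NoSwapRegret fun _ => μ := fun i φ hφ ε hε => Eventually.of_forall fun T =>
  (Finset.sum_le_sum fun _ _ => hμ i φ hφ).trans
    (le_add_of_nonneg_right (EReal.coe_nonneg.2 (by positivity)))

theorem empirical_const {Ω : Type*} [MeasurableSpace Ω] (μ : ProbabilityMeasure Ω) (T : ℕ) :
    empirical (fun _ => μ) T = μ := by
  refine Subtype.ext ?_
  change ((T + 1 : ℕ) : ENNReal)⁻¹ • ∑ t ∈ Finset.range (T + 1), (μ : Measure Ω) = μ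
  rw [Finset.sum_const, Finset.card_range, ← Nat.cast_smul_eq_nsmul ENNReal, smul_smul,
    ENNReal.inv_mul_cancel (by simp) (ENNReal.natCast_ne_top _), one_smul]

end FisherMarket

theorem mainTheorem11 {ι κ : Type*} [Fintype ι] [Fintype κ] [DecidableEq ι]
    (M : FisherMarket ι κ) (hM : M.IsGeneric) :
    ∃ b : M.BidProfile,
      (∀ b' : M.BidProfile, M.IsEquilibriumBid b' ↔ b' = b) ∧
      (∀ μ : ProbabilityMeasure M.BidProfile,
        M.IsCorrelatedEquilibrium μ ↔ μ = diracProba b) ∧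
      ∀ P : ℕ → ProbabilityMeasure M.BidProfile, M.NoSwapRegret P →
        Tendsto (FisherMarket.empirical P) atTop (𝓝 (diracProba b)) := by
  obtain ⟨b, hb⟩ := M.exists_isBalanced
  have hmax : ∀ c : M.BidProfile, (∀ i, M.AdmissibleBid i (c i)) → c ≠ b →
      M.potential c < M.potential b := fun c hc hne => by
    by_contra! h
    -- otherwise `c` is a maximizer as well, hence balanced
    refine hne (hb.unique hM (FisherMarket.isBalanced_of_isMax hc fun d hd => ?_))
    exact (hb.potential_le hd).trans h
  have hlim : ∀ P : ℕ → ProbabilityMeasure M.BidProfile, M.NoSwapRegret P →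
      Tendsto (FisherMarket.empirical P) atTop (𝓝 (diracProba b)) := fun P hP =>
    hP.tendsto_empirical hb.admissibleBid hmax
  refine ⟨b, fun b' => ?_, fun μ => ⟨fun hμ => ?_, ?_⟩, hlim⟩
  · rw [FisherMarket.isEquilibriumBid_iff]
    refine ⟨fun h => hb.unique hM h, ?_⟩
    rintro rfl
    exact hb
  · have h := hlim _ hμ.noSwapRegret
    have h1 : FisherMarket.empirical (fun _ => μ) = fun _ => μ :=
      funext fun T => FisherMarket.empirical_const μ T
    rw [h1] at h
    exact tendsto_nhds_unique tendsto_const_nhds h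
  · rintro rfl
    exact hb.isCorrelatedEquilibrium_diracProba
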